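/- For $r\ge 1$ and real $z_1,\dots,z_r$ let $$M_r^{(2)}(z_1,\dots,z_r)=\sum_{\alpha_1,\dots,\alpha_r\ge 0}\binom{\alpha_1+\cdots+\alpha_r}{\alpha_1,\dots,\alpha_r}^2 z_1^{\alpha_1}\cdots z_r^{\alpha_r},$$ and let $K(k)=\int_0^1\frac{dt}{\sqrt{(1-t^2)(1-k^2t^2)}}$, $0\le k<1$, be the complete elliptic integral of the first kind. For $\tau\in\{+1,-1\}$ and $x=(x_1,x_2,x_3)$ put $$\varkappa_\tau(x)=\prod_{\substack{\sigma_1,\sigma_2,\sigma_3\in\{\pm1\}\\ \sigma_1\sigma_2\sigma_3=\tau}}\sqrt{1+\sigma_1x_1+\sigma_2x_2+\sigma_3x_3},$$ $$k(x)=\left(\frac{\sqrt{\varkappa_+(x)}-\sqrt{\varkappa_-(x)}}{\sqrt{\varkappa_+(x)}+\sqrt{\varkappa_-(x)}}\right)^2,\qquad m(x)=\frac{8}{\pi\left(\sqrt{\varkappa_+(x)}+\sqrt{\varkappa_-(x)}\right)^2}.$$ (a) For all integers $\alpha_1,\alpha_2,\alpha_3\ge0$, the coefficient $\binom{\alpha_1+\alpha_2+\alpha_3}{\alpha_1,\alpha_2,\alpha_3}^2$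 is the number of ordered pairs of lattice paths in $\mathbb Z^3$ from the origin to $(\alpha_1,\alpha_2,\alpha_3)$ all of whose steps are positive unit coordinate vectors. (b) For all real $x_1,x_2,x_3$ with $|x_1|+|x_2|+|x_3|<1$ we have $0\le k(x)<1$, the series $M_3^{(2)}(x_1^2,x_2^2,x_3^2)$ converges, and $$M_3^{(2)}(x_1^2,x_2^2,x_3^2)=m(x)\,K(k(x)).$$ (c) $k$ and $m$ are symmetric functions of $x_1,x_2,x_3$. (d) The formula reduces to that for $M_2^{(2)}$ when $x_3=0$: $K(0)=\pi/2$, and for all real $x_1,x_2$ with $|x_1|+|x_2|<1$, writing $D=\sqrt{\big(1-(x_1^2+x_2^2)\big)^2-4x_1^2x_2^2}$, we have $\varkappa_+(x_1,x_2,0)=\varkappa_-(x_1,x_2,0)=D$, $k(x_1,x_2,0)=0$, $m(x_1,x_2,0)=\frac{2}{\pi D}$, the series $M_2^{(2)}(x_1^2,x_2^2)$ converges, and $$M_3^{(2)}(x_1^2,x_2^2,0)=M_2^{(2)}(x_1^2,x_2^2)=\frac1D .$$ -/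

import Mathlib

/-- The generating function `∑_α multinomial(α)² z^α` of the squares of the multinomial
coefficients in `r` variables, evaluated at a real point `z`. -/
noncomputable def multinomialSqGF {r : ℕ} (z : Fin r → ℝ) : ℝ :=
  ∑' α : Fin r → ℕ, ((Nat.multinomial Finset.univ α : ℕ) : ℝ) ^ 2 * ∏ i, z i ^ α i

/-- The series defining `multinomialSqGF z` converges (unconditionally). -/
def MultinomialSqSummable {r : ℕ} (z : Fin r → ℝ) : Prop :=
  Summable fun α : Fin r → ℕ =>
    ((Nat.multinomial Finset.univ α : ℕ) : ℝ) ^ 2 * ∏ i, z i ^ α i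

/-- Lattice paths in `ℤ^r` from the origin to `α`, all of whose steps are positive unit
coordinate vectors; a path is given by the list of its steps. -/
def latticePaths {r : ℕ} (α : Fin r → ℕ) : Set (List (Fin r → ℤ)) :=
  {p | (∀ v ∈ p, ∃ i, v = Pi.single i 1) ∧ p.sum = fun i => (α i : ℤ)}

/-- The complete elliptic integral of the first kind, as a function of the modulus `k`
(meant for `0 ≤ k < 1`). -/
noncomputable def ellipticK (k : ℝ) : ℝ :=
  ∫ t in (0 : ℝ)..1, 1 / Real.sqrt ((1 - t ^ 2) * (1 - k ^ 2 * t ^ 2))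

/-- The product of `√(1 + σ₁x₁ + σ₂x₂ + σ₃x₃)` over the four sign vectors `σ` with
`σ₁σ₂σ₃ = τ`. -/
noncomputable def signedKappa (τ : ℤˣ) (x : Fin 3 → ℝ) : ℝ :=
  ∏ σ : Fin 3 → ℤˣ with ∏ i, σ i = τ, Real.sqrt (1 + ∑ i, ((σ i : ℤ) : ℝ) * x i)

/-- The elliptic modulus `k(x)`. -/
noncomputable def ellipticModulus (x : Fin 3 → ℝ) : ℝ :=
  ((Real.sqrt (signedKappa 1 x) - Real.sqrt (signedKappa (-1) x)) /
    (Real.sqrt (signedKappa 1 x) + Real.sqrt (signedKappa (-1) x))) ^ 2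

/-- The prefactor `m(x)`. -/
noncomputable def ellipticPrefactor (x : Fin 3 → ℝ) : ℝ :=
  8 / (Real.pi *
    (Real.sqrt (signedKappa 1 x) + Real.sqrt (signedKappa (-1) x)) ^ 2)

/-! The generating function is an elliptic integral because squared binomial coefficients are
constant Fourier terms. Since `(x² + y² + 2xy cos φ)^n = |x e^{iφ} + y|^{2n}`, averaging over `φ`
gives the degree-`n` part of `M₂(x², y²)`; summing over `n` gives a geometric series, whose average
is `1/D`.

For three variables, the multinomial coefficient splits as `C(a+b+c, a) · C(b+c, b)`. Averaging out
the last two variables in the same way gives `M₃(x², y², z²)` as the mean over `φ` of `M₂(x², ρ²)`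
with `ρ² = y² + z² + 2yz cos φ`. In the closed form for `M₂` the radicand factors into two terms
linear in `cos φ`, and a scaled half-angle substitution turns the mean into `(2/π) · agmIntegral κ₊
κ₋` (`integral_one_div_sqrt_mul_eq_agmIntegral`). Two Landen steps (`agmIntegral_sq_sq`) convert
this into `m · K(k)`. -/

open MeasureTheory

/-! ### The AGM integral, Landen's transformation and `K` -/

/-- The integral `∫₀^∞ dw / √((w² + A²)(w² + B²))`, which equals `π / (2 agm(A, B))`. -/
noncomputable def agmIntegral (A B : ℝ) : ℝ :=
  ∫ w in Set.Ioi (0 : ℝ), 1 / √((w ^ 2 + A ^ 2) * (w ^ 2 + B ^ 2))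

/-- Substitute `u = (w - AB/w)/2`, a bijection from `(0, ∞)` onto `ℝ`. Then `u² + AB` is the square
of `(w + AB/w)/2`, which the Jacobian cancels up to a factor `w`, while `u² + ((A+B)/2)² = (w² +
A²)(w² + B²)/(4w²)`. The integrand is even in `u`, which accounts for the half-line on both sides.
-/
theorem agmIntegral_landen {A B : ℝ} (hA : 0 < A) (hB : 0 < B) :
    agmIntegral ((A + B) / 2) (√(A * B)) = agmIntegral A B := by
  have hAB : 0 < A * B := mul_pos hA hB
  set g : ℝ → ℝ := fun u => 1 / √((u ^ 2 + ((A + B) / 2) ^ 2) * (u ^ 2 + √(A * B) ^ 2)) with hg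
  set f : ℝ → ℝ := fun w => (w - A * B / w) / 2 with hf
  have hderiv : ∀ w ∈ Set.Ioi (0 : ℝ),
      HasDerivWithinAt f ((1 + A * B / w ^ 2) / 2) (Set.Ioi 0) w := by
    intro w hw
    have hw0 : w ≠ 0 := (Set.mem_Ioi.1 hw).ne'
    have h := (((hasDerivAt_id w).sub ((hasDerivAt_inv hw0).const_mul (A * B))).div_const 2)
    refine h.hasDerivWithinAt.congr_deriv ?_
    field_simp
    ring
  have hinj : Set.InjOn f (Set.Ioi 0) := by
    intro v hv w hw hvw
    have hv0 : 0 < v := hv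
    have hw0 : 0 < w := hw
    simp only [hf] at hvw
    field_simp at hvw
    have : (v - w) * (v * w + A * B) = 0 := by linear_combination hvw
    rcases mul_eq_zero.1 this with h | h
    · linarith
    · nlinarith [mul_pos hv0 hw0]
  have himage : f '' Set.Ioi 0 = Set.univ := by
    refine Set.eq_univ_of_forall fun u => ?_
    have hs : √(u ^ 2 + A * B) ^ 2 = u ^ 2 + A * B := Real.sq_sqrt (by positivity)
    have habs : |u| < √(u ^ 2 + A * B) := by
      rw [← Real.sqrt_sq_eq_abs]
      exact Real.sqrt_lt_sqrt (sq_nonneg u) (by linarith)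
    have hpos : 0 < u + √(u ^ 2 + A * B) := by linarith [neg_abs_le u]
    -- The positive root of `w² - 2uw - AB = 0`.
    refine ⟨u + √(u ^ 2 + A * B), hpos, ?_⟩
    simp only [hf]
    field_simp
    linear_combination hs
  have key := integral_image_eq_integral_abs_deriv_smul measurableSet_Ioi hderiv hinj g
  have heven : (∫ u, g u) = 2 * agmIntegral ((A + B) / 2) (√(A * B)) := by
    have := integral_comp_abs (f := g)
    simpa [hg, agmIntegral, sq_abs] using this
  rw [himage, Measure.restrict_univ, heven] at key
  have hrhs : (∫ w in Set.Ioi (0 : ℝ), |(1 + A * B / w ^ 2) / 2| • g (f w)) =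
      2 * agmIntegral A B := by
    rw [agmIntegral, ← integral_const_mul]
    refine setIntegral_congr_fun measurableSet_Ioi fun w hw => ?_
    have hw0 : 0 < w := hw
    have h1 : (f w ^ 2 + ((A + B) / 2) ^ 2) * (f w ^ 2 + √(A * B) ^ 2) =
        ((w ^ 2 + A ^ 2) * (w ^ 2 + B ^ 2)) * ((w ^ 2 + A * B) / (4 * w ^ 2)) ^ 2 := by
      rw [Real.sq_sqrt hAB.le]
      simp only [hf]
      field_simp
      ring
    have h2 : 0 < √((w ^ 2 + A ^ 2) * (w ^ 2 + B ^ 2)) := Real.sqrt_pos.2 (by positivity)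
    simp only [hg, smul_eq_mul]
    rw [h1, Real.sqrt_mul (by positivity), Real.sqrt_sq (by positivity),
      abs_of_pos (by positivity)]
    field_simp
    ring
  rw [hrhs] at key
  linarith

theorem agmIntegral_mul_mul {c : ℝ} (hc : 0 < c) (A B : ℝ) :
    agmIntegral (c * A) (c * B) = agmIntegral A B / c := by
  have h := integral_comp_mul_left_Ioi
    (fun w => 1 / √((w ^ 2 + (c * A) ^ 2) * (w ^ 2 + (c * B) ^ 2))) 0 hc
  rw [mul_zero, smul_eq_mul] at h
  have h2 : (∫ w in Set.Ioi (0 : ℝ),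
      1 / √(((c * w) ^ 2 + (c * A) ^ 2) * ((c * w) ^ 2 + (c * B) ^ 2))) =
      (c ^ 2)⁻¹ * agmIntegral A B := by
    rw [agmIntegral, ← integral_const_mul]
    refine setIntegral_congr_fun measurableSet_Ioi fun w _ => ?_
    have : ((c * w) ^ 2 + (c * A) ^ 2) * ((c * w) ^ 2 + (c * B) ^ 2) =
        (c ^ 2) ^ 2 * ((w ^ 2 + A ^ 2) * (w ^ 2 + B ^ 2)) := by ring
    simp only [this]
    rw [Real.sqrt_mul (by positivity), Real.sqrt_sq (by positivity), one_div, mul_inv, one_div]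
  rw [h2] at h
  change _ = c⁻¹ * agmIntegral (c * A) (c * B) at h
  field_simp at h ⊢
  linarith

/-- Substitute `t = w/√(b² + w²)` with `b² = 1 - k²`, which sends `(0, ∞)` onto `(0, 1)`. -/
theorem ellipticK_eq_agmIntegral {k : ℝ} (hk0 : 0 ≤ k) (hk1 : k < 1) :
    ellipticK k = agmIntegral 1 (√(1 - k ^ 2)) := by
  have hk : 0 < 1 - k ^ 2 := by nlinarith
  set b : ℝ := √(1 - k ^ 2) with hb
  have hb0 : 0 < b := Real.sqrt_pos.2 hk
  have hb2 : b ^ 2 = 1 - k ^ 2 := Real.sq_sqrt hk.le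
  set g : ℝ → ℝ := fun t => 1 / √((1 - t ^ 2) * (1 - k ^ 2 * t ^ 2)) with hg
  set f : ℝ → ℝ := fun w => w / √(b ^ 2 + w ^ 2) with hf
  have hderiv : ∀ w ∈ Set.Ioi (0 : ℝ),
      HasDerivWithinAt f (b ^ 2 / ((b ^ 2 + w ^ 2) * √(b ^ 2 + w ^ 2))) (Set.Ioi 0) w := by
    intro w _
    have hpos : 0 < b ^ 2 + w ^ 2 := by positivity
    have hs : √(b ^ 2 + w ^ 2) ^ 2 = b ^ 2 + w ^ 2 := Real.sq_sqrt hpos.le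
    have hs0 : 0 < √(b ^ 2 + w ^ 2) := Real.sqrt_pos.2 hpos
    have h := (hasDerivAt_id' w).div
      (((hasDerivAt_pow 2 w).const_add (b ^ 2)).sqrt hpos.ne') hs0.ne'
    refine h.hasDerivWithinAt.congr_deriv ?_
    rw [hs]
    field_simp
    rw [hs]
    norm_num
    ring
  have hsq : ∀ w, f w ^ 2 = w ^ 2 / (b ^ 2 + w ^ 2) := by
    intro w
    simp only [hf]
    rw [div_pow, Real.sq_sqrt (by positivity)]
  have hinj : Set.InjOn f (Set.Ioi 0) := by
    intro v hv w hw hvw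
    have hv0 : 0 < v := hv
    have hw0 : 0 < w := hw
    have h : f v ^ 2 = f w ^ 2 := by rw [hvw]
    rw [hsq, hsq, div_eq_div_iff (by positivity) (by positivity)] at h
    have h' : v ^ 2 = w ^ 2 := mul_right_cancel₀ (pow_ne_zero 2 hb0.ne') (by linarith)
    exact (sq_eq_sq₀ hv0.le hw0.le).1 h'
  have himage : f '' Set.Ioi 0 = Set.Ioo 0 1 := by
    ext t
    constructor
    · rintro ⟨w, hw, rfl⟩
      have hw0 : 0 < w := hw
      refine ⟨by simp only [hf]; positivity, ?_⟩
      simp only [hf]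
      rw [div_lt_one (by positivity)]
      exact Real.lt_sqrt_of_sq_lt (by nlinarith)
    · rintro ⟨h0, h1⟩
      have ht : 0 < 1 - t ^ 2 := by nlinarith
      have hs : √(1 - t ^ 2) ^ 2 = 1 - t ^ 2 := Real.sq_sqrt ht.le
      have hs0 : 0 < √(1 - t ^ 2) := Real.sqrt_pos.2 ht
      refine ⟨b * t / √(1 - t ^ 2), by simp only [Set.mem_Ioi]; positivity, ?_⟩
      have h : b ^ 2 + (b * t / √(1 - t ^ 2)) ^ 2 = (b / √(1 - t ^ 2)) ^ 2 := by
        field_simp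
        rw [hs]
        ring
      simp only [hf]
      rw [h, Real.sqrt_sq (by positivity)]
      field_simp
  have key := integral_image_eq_integral_abs_deriv_smul measurableSet_Ioi hderiv hinj g
  rw [ellipticK, intervalIntegral.integral_of_le zero_le_one, integral_Ioc_eq_integral_Ioo,
    ← himage, key, agmIntegral]
  refine setIntegral_congr_fun measurableSet_Ioi fun w hw => ?_
  have hw0 : 0 < w := hw
  have hpos : 0 < b ^ 2 + w ^ 2 := by positivity
  have hs : √(b ^ 2 + w ^ 2) ^ 2 = b ^ 2 + w ^ 2 := Real.sq_sqrt hpos.le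
  have h1 : (1 - f w ^ 2) * (1 - k ^ 2 * f w ^ 2) =
      (b ^ 2 / (b ^ 2 + w ^ 2)) ^ 2 * (w ^ 2 + 1) := by
    rw [hsq, show k ^ 2 = 1 - b ^ 2 by linarith]
    field_simp
    ring
  have h2 : 0 < √(w ^ 2 + 1) := Real.sqrt_pos.2 (by positivity)
  simp only [hg, smul_eq_mul]
  rw [h1, Real.sqrt_mul (by positivity), Real.sqrt_sq (by positivity),
    abs_of_pos (by positivity), one_pow, Real.sqrt_mul (by positivity), add_comm (w ^ 2) (b ^ 2)]
  field_simp

theorem agmIntegral_one_one : agmIntegral 1 1 = Real.pi / 2 := by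
  have h := integral_Ioi_inv_one_add_sq (i := 0)
  rw [Real.arctan_zero, sub_zero] at h
  rw [← h, agmIntegral]
  refine setIntegral_congr_fun measurableSet_Ioi fun w _ => ?_
  have : (w ^ 2 + (1 : ℝ) ^ 2) * (w ^ 2 + 1 ^ 2) = (1 + w ^ 2) ^ 2 := by ring
  simp only [this]
  rw [Real.sqrt_sq (by positivity), one_div]

theorem agmIntegral_self {A : ℝ} (hA : 0 < A) : agmIntegral A A = Real.pi / (2 * A) := by
  have h := agmIntegral_mul_mul hA 1 1
  rw [mul_one, agmIntegral_one_one] at h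
  rw [h]
  field_simp

/-- Two Landen transformations bring the complete elliptic integral of modulus
`((a - b) / (a + b))²` to the integral with parameters `a²` and `b²`. -/
theorem agmIntegral_sq_sq {a b : ℝ} (ha : 0 < a) (hb : 0 < b) :
    agmIntegral (a ^ 2) (b ^ 2) =
      4 / (a + b) ^ 2 * ellipticK (((a - b) / (a + b)) ^ 2) := by
  have hlt : ((a - b) / (a + b)) ^ 2 < 1 := by
    rw [div_pow, div_lt_one (by positivity)]
    nlinarith [mul_pos ha hb]
  -- The AGM iteration runs `(a², b²) → ((a² + b²)/2, ab) → ((a + b)²/4, √(ab(a² + b²)/2))`;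
  -- dividing by `(a + b)²/4` then makes the first parameter `1` and the second the complementary
  -- modulus.
  have h1 := agmIntegral_landen (pow_pos ha 2) (pow_pos hb 2)
  have h2 := agmIntegral_landen (A := (a ^ 2 + b ^ 2) / 2) (B := a * b)
    (by positivity) (by positivity)
  rw [← mul_pow, Real.sqrt_sq (by positivity)] at h1
  rw [← h1, ← h2, ellipticK_eq_agmIntegral (sq_nonneg _) hlt]
  have h3 := agmIntegral_mul_mul (c := (a + b) ^ 2 / 4) (by positivity) 1
    (√(1 - (((a - b) / (a + b)) ^ 2) ^ 2))
  have h4 : (a + b) ^ 2 / 4 * √(1 - (((a - b) / (a + b)) ^ 2) ^ 2) =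
      √((a ^ 2 + b ^ 2) / 2 * (a * b)) := by
    rw [← Real.sqrt_sq (show 0 ≤ (a + b) ^ 2 / 4 by positivity), ← Real.sqrt_mul (by positivity)]
    congr 1
    field_simp
    ring
  rw [h4, mul_one] at h3
  rw [show ((a ^ 2 + b ^ 2) / 2 + a * b) / 2 = (a + b) ^ 2 / 4 by ring, h3]
  field_simp

/-! ### Trigonometric integrals over `[0, π]` -/

/-- Half-angle substitution `c u = tan(φ/2)`; the free scale `c` serves to normalise the resulting
quadratics in `u`. -/
theorem integral_cos_comp_eq_integral_Ioi (g : ℝ → ℝ) {c : ℝ} (hc : 0 < c) :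
    ∫ φ in (0 : ℝ)..Real.pi, g (Real.cos φ) =
      ∫ u in Set.Ioi (0 : ℝ), 2 * c / (1 + (c * u) ^ 2) *
        g ((1 - (c * u) ^ 2) / (1 + (c * u) ^ 2)) := by
  set f : ℝ → ℝ := fun u => 2 * Real.arctan (c * u) with hf
  have hderiv : ∀ u ∈ Set.Ioi (0 : ℝ),
      HasDerivWithinAt f (2 * c / (1 + (c * u) ^ 2)) (Set.Ioi 0) u := by
    intro u _
    have h := (((hasDerivAt_id' u).const_mul c).arctan).const_mul 2
    refine h.hasDerivWithinAt.congr_deriv ?_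
    field_simp
  have hinj : Set.InjOn f (Set.Ioi 0) := by
    intro v _ w _ hvw
    have h := Real.arctan_injective (mul_left_cancel₀ two_ne_zero hvw)
    exact mul_left_cancel₀ hc.ne' h
  have himage : f '' Set.Ioi 0 = Set.Ioo 0 Real.pi := by
    ext t
    constructor
    · rintro ⟨w, hw, rfl⟩
      have hw0 : 0 < w := hw
      have h1 := Real.arctan_pos.2 (mul_pos hc hw0)
      have h2 := Real.arctan_lt_pi_div_two (c * w)
      constructor <;> simp only [hf] <;> linarith
    · rintro ⟨h0, h1⟩
      have ht : 0 < Real.tan (t / 2) := Real.tan_pos_of_pos_of_lt_pi_div_two (by linarith)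
        (by linarith)
      refine ⟨Real.tan (t / 2) / c, div_pos ht hc, ?_⟩
      simp only [hf]
      rw [mul_div_cancel₀ _ hc.ne', Real.arctan_tan (by linarith) (by linarith)]
      ring
  have key := integral_image_eq_integral_abs_deriv_smul measurableSet_Ioi hderiv hinj
    (fun φ => g (Real.cos φ))
  rw [intervalIntegral.integral_of_le Real.pi_pos.le, integral_Ioc_eq_integral_Ioo,
    ← himage, key]
  refine setIntegral_congr_fun measurableSet_Ioi fun u _ => ?_
  have hcos : Real.cos (f u) = (1 - (c * u) ^ 2) / (1 + (c * u) ^ 2) := by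
    simp only [hf]
    rw [Real.cos_two_mul, Real.cos_sq_arctan]
    field_simp
    ring
  simp only [smul_eq_mul]
  rw [hcos, abs_of_nonneg (by positivity)]

theorem integral_one_div_sqrt_mul_eq_agmIntegral {P₁ P₂ Q : ℝ} (h₁ : |Q| < P₁) (h₂ : |Q| < P₂) :
    ∫ φ in (0 : ℝ)..Real.pi,
        1 / √((P₁ - Q * Real.cos φ) * (P₂ - Q * Real.cos φ)) =
      2 * agmIntegral (√((P₁ - Q) * (P₂ + Q))) (√((P₁ + Q) * (P₂ - Q))) := by
  obtain ⟨a₁, b₁⟩ := abs_lt.1 h₁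
  obtain ⟨a₂, b₂⟩ := abs_lt.1 h₂
  have p₁ : 0 < P₁ + Q := by linarith
  have p₂ : 0 < P₂ + Q := by linarith
  have m₁ : 0 < P₁ - Q := by linarith
  have m₂ : 0 < P₂ - Q := by linarith
  -- Under the substitution `P - Q cos φ` becomes `((P - Q) + (P + Q)(cu)²)/(1 + (cu)²)`. This `c`
  -- makes both quadratics monic after extracting a total factor `c²`, whose root cancels the `c` in
  -- the Jacobian.
  set c : ℝ := (√((P₁ + Q) * (P₂ + Q)))⁻¹ with hc
  have hc0 : 0 < c := by positivity
  have hc2 : c ^ 2 = ((P₁ + Q) * (P₂ + Q))⁻¹ := by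
    rw [hc, inv_pow, Real.sq_sqrt (by positivity)]
  rw [integral_cos_comp_eq_integral_Ioi
    (fun t => 1 / √((P₁ - Q * t) * (P₂ - Q * t))) hc0, agmIntegral, ← integral_const_mul]
  refine setIntegral_congr_fun measurableSet_Ioi fun u _ => ?_
  rw [Real.sq_sqrt (by positivity), Real.sq_sqrt (by positivity)]
  have h : (P₁ - Q * ((1 - (c * u) ^ 2) / (1 + (c * u) ^ 2))) *
      (P₂ - Q * ((1 - (c * u) ^ 2) / (1 + (c * u) ^ 2))) =
      (c / (1 + (c * u) ^ 2)) ^ 2 *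
        ((u ^ 2 + (P₁ - Q) * (P₂ + Q)) * (u ^ 2 + (P₁ + Q) * (P₂ - Q))) := by
    rw [div_pow, mul_pow c u, hc2]
    field_simp
    ring
  have hpos : 0 < √((u ^ 2 + (P₁ - Q) * (P₂ + Q)) * (u ^ 2 + (P₁ + Q) * (P₂ - Q))) := by
    positivity
  rw [h, Real.sqrt_mul (by positivity), Real.sqrt_sq (by positivity)]
  field_simp

/-- The case `P₁ = P₂`, where the two AGM parameters coincide and the integral is elementary. -/
theorem integral_one_div_sub_mul_cos {P Q : ℝ} (h : |Q| < P) :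
    ∫ φ in (0 : ℝ)..Real.pi, 1 / (P - Q * Real.cos φ) = Real.pi / √(P ^ 2 - Q ^ 2) := by
  obtain ⟨h₁, h₂⟩ := abs_lt.1 h
  have hPQ : 0 < P ^ 2 - Q ^ 2 := by nlinarith
  have key := integral_one_div_sqrt_mul_eq_agmIntegral h h
  rw [show (P - Q) * (P + Q) = P ^ 2 - Q ^ 2 by ring,
    show (P + Q) * (P - Q) = P ^ 2 - Q ^ 2 by ring, agmIntegral_self (Real.sqrt_pos.2 hPQ)] at key
  calc _ = ∫ φ in (0 : ℝ)..Real.pi, 1 / √((P - Q * Real.cos φ) * (P - Q * Real.cos φ)) := by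
        congr 1
        ext φ
        rw [Real.sqrt_mul_self]
        have h3 : |Q * Real.cos φ| ≤ |Q| := by
          rw [abs_mul]
          exact mul_le_of_le_one_right (abs_nonneg Q) (Real.abs_cos_le_one φ)
        linarith [le_abs_self (Q * Real.cos φ)]
    _ = _ := by
        rw [key]
        field_simp

/-! ### Squared binomial coefficients as Fourier constant terms -/

theorem integral_cos_int_mul (m : ℤ) :
    ∫ φ in (0 : ℝ)..Real.pi, Real.cos (m * φ) = if m = 0 then Real.pi else 0 := by
  split_ifs with hm
  · simp [hm]
  · have hm' : (m : ℝ) ≠ 0 := by exact_mod_cast hm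
    rw [intervalIntegral.integral_comp_mul_left _ hm', integral_cos]
    simp [Real.sin_int_mul_pi]

/-- Factor the base as `(x e^{iφ} + y)(x e^{-iφ} + y)`, expand both powers binomially and take real
parts. -/
theorem sq_add_sq_add_two_mul_cos_pow (x y φ : ℝ) (n : ℕ) :
    (x ^ 2 + y ^ 2 + 2 * x * y * Real.cos φ) ^ n =
      ∑ j ∈ Finset.range (n + 1), ∑ k ∈ Finset.range (n + 1),
        ((x ^ j * y ^ (n - j) * n.choose j) * (x ^ k * y ^ (n - k) * n.choose k)) *
          Real.cos (((j : ℤ) - (k : ℤ) : ℤ) * φ) := by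
  set E := Complex.exp (φ * Complex.I) with hE
  set E' := Complex.exp (-φ * Complex.I) with hE'
  have hEE : E * E' = 1 := by
    rw [hE, hE', ← Complex.exp_add]
    simp
  have hcos : 2 * Complex.cos φ = E + E' := by
    rw [Complex.two_cos]
  have hfac : ((x : ℂ) ^ 2 + y ^ 2 + 2 * x * y * Complex.cos φ) = (x * E + y) * (x * E' + y) := by
    linear_combination (x * y : ℂ) * hcos - (x : ℂ) ^ 2 * hEE
  have hterm : ∀ j k : ℕ, E ^ j * E' ^ k = Complex.exp ((((j : ℤ) - (k : ℤ) : ℤ) * φ : ℝ) * Complex.I) := by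
    intro j k
    rw [hE, hE', ← Complex.exp_nat_mul, ← Complex.exp_nat_mul, ← Complex.exp_add]
    congr 1
    push_cast
    ring
  have hsum : (((x ^ 2 + y ^ 2 + 2 * x * y * Real.cos φ) ^ n : ℝ) : ℂ) =
      ∑ j ∈ Finset.range (n + 1), ∑ k ∈ Finset.range (n + 1),
        (((x ^ j * y ^ (n - j) * n.choose j) * (x ^ k * y ^ (n - k) * n.choose k) : ℝ) : ℂ) *
          Complex.exp ((((j : ℤ) - (k : ℤ) : ℤ) * φ : ℝ) * Complex.I) := by
    push_cast
    rw [hfac, mul_pow, add_pow, add_pow, Finset.sum_mul_sum]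
    refine Finset.sum_congr rfl fun j _ => Finset.sum_congr rfl fun k _ => ?_
    have := hterm j k
    push_cast at this
    rw [← this]
    ring
  have hre := congrArg Complex.re hsum
  rw [Complex.ofReal_re] at hre
  rw [hre, Complex.re_sum]
  refine Finset.sum_congr rfl fun j _ => ?_
  rw [Complex.re_sum]
  refine Finset.sum_congr rfl fun k _ => ?_
  rw [Complex.re_ofReal_mul, Complex.exp_ofReal_mul_I_re]

/-- Orthogonality of the cosines leaves only the diagonal `j = k`, where the binomial coefficients
appear squared. -/
theorem integral_sq_add_sq_add_two_mul_cos_pow (x y : ℝ) (n : ℕ) :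
    ∫ φ in (0 : ℝ)..Real.pi, (x ^ 2 + y ^ 2 + 2 * x * y * Real.cos φ) ^ n =
      Real.pi * ∑ p ∈ Finset.HasAntidiagonal.antidiagonal n,
        ((p.1 + p.2).choose p.1 : ℝ) ^ 2 * ((x ^ 2) ^ p.1 * (y ^ 2) ^ p.2) := by
  simp_rw [sq_add_sq_add_two_mul_cos_pow]
  have hcont : ∀ (c : ℝ) (m : ℤ), IntervalIntegrable (fun φ => c * Real.cos (m * φ)) volume 0
      Real.pi := fun c m => (by fun_prop : Continuous _).intervalIntegrable _ _
  rw [intervalIntegral.integral_finsetSum fun j _ => by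
    exact (by fun_prop : Continuous _).intervalIntegrable _ _,
    Finset.Nat.sum_antidiagonal_eq_sum_range_succ_mk, Finset.mul_sum]
  refine Finset.sum_congr rfl fun j hj => ?_
  rw [intervalIntegral.integral_finsetSum fun k _ => hcont _ _]
  simp_rw [intervalIntegral.integral_const_mul, integral_cos_int_mul, sub_eq_zero, Nat.cast_inj]
  have hjn : j ≤ n := Nat.lt_succ_iff.1 (Finset.mem_range.1 hj)
  simp only [mul_ite, mul_zero, Finset.sum_ite_eq, hj, if_true]
  rw [Nat.add_sub_cancel' hjn]
  ring

/-! ### Convergence -/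

theorem HasSum.congr_left {ι : Type*} {f g : ι → ℝ} {a : ℝ} (hf : HasSum f a)
    (h : ∀ i, f i = g i) : HasSum g a :=
  (funext h : f = g) ▸ hf

/-- By the multinomial theorem the terms of total degree `n` add up to `(∑ w i)^n`, so finite
partial sums are bounded by a geometric series. -/
theorem summable_multinomial_mul_prod_pow {r : ℕ} {w : Fin r → ℝ} (hw : ∀ i, 0 ≤ w i)
    (h : ∑ i, w i < 1) :
    Summable fun α : Fin r → ℕ => (Nat.multinomial Finset.univ α : ℝ) * ∏ i, w i ^ α i := by
  have hnn : ∀ α : Fin r → ℕ, 0 ≤ (Nat.multinomial Finset.univ α : ℝ) * ∏ i, w i ^ α i :=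
    fun α => mul_nonneg (Nat.cast_nonneg _) (Finset.prod_nonneg fun i _ => pow_nonneg (hw i) _)
  have hW : 0 ≤ ∑ i, w i := Finset.sum_nonneg fun i _ => hw i
  refine summable_of_sum_le (c := (1 - ∑ i, w i)⁻¹) hnn fun u => ?_
  have hmaps : ∀ α ∈ u, (∑ i, α i) ∈ Finset.range (u.sup (fun α => ∑ i, α i) + 1) :=
    fun α hα => Finset.mem_range.2
      (Nat.lt_succ_of_le (Finset.le_sup (f := fun α : Fin r → ℕ => ∑ i, α i) hα))
  rw [← Finset.sum_fiberwise_of_maps_to hmaps]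
  refine le_trans (Finset.sum_le_sum fun n _ => ?_)
    ((summable_geometric_of_lt_one hW h).sum_le_tsum _ (fun n _ => pow_nonneg hW n)
      |>.trans_eq (tsum_geometric_of_lt_one hW h))
  rw [Finset.sum_pow_eq_sum_piAntidiag]
  refine Finset.sum_le_sum_of_subset_of_nonneg (fun α hα => ?_) fun α _ _ => hnn α
  simpa using (Finset.mem_filter.1 hα).2

/-- Each term is the square of a term of the summable series at `|x i|`, hence lies on the diagonal
of a summable product family. -/
theorem multinomialSqSummable_sq {r : ℕ} {x : Fin r → ℝ} (h : ∑ i, |x i| < 1) :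
    MultinomialSqSummable fun i => x i ^ 2 := by
  have hs := summable_multinomial_mul_prod_pow (fun i => abs_nonneg (x i)) h
  have hnn : 0 ≤ fun α : Fin r → ℕ =>
      (Nat.multinomial Finset.univ α : ℝ) * ∏ i, |x i| ^ α i :=
    fun α => mul_nonneg (Nat.cast_nonneg _)
      (Finset.prod_nonneg fun i _ => pow_nonneg (abs_nonneg _) _)
  have hinj : Function.Injective fun α : Fin r → ℕ => (α, α) := fun _ _ h => (Prod.mk.inj h).1
  refine ((hs.mul_of_nonneg hs hnn hnn).comp_injective hinj).congr fun α => ?_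
  simp only [Function.comp_apply]
  rw [mul_mul_mul_comm, ← Finset.prod_mul_distrib, ← sq]
  congr 1
  refine Finset.prod_congr rfl fun i _ => ?_
  rw [← mul_pow, ← sq, sq_abs]

/-! ### Two variables in closed form, three variables as an integral -/

/-- Triples as pairs of a number and a pair, against functions on `Fin 3`. -/
def prodProdEquivFinThree : ℕ × ℕ × ℕ ≃ (Fin 3 → ℕ) where
  toFun p := ![p.1, p.2.1, p.2.2]
  invFun α := (α 0, α 1, α 2)
  left_inv _ := rfl
  right_inv α := by
    ext i
    fin_cases i <;> rfl

/-- Triples, sorted by the sum of the last two entries. -/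
def sigmaAntidiagonalEquivProdProd :
    (Σ q : ℕ × ℕ, Finset.HasAntidiagonal.antidiagonal q.2) ≃ ℕ × ℕ × ℕ where
  toFun s := (s.1.1, s.2.1)
  invFun p := ⟨(p.1, p.2.1 + p.2.2), ⟨p.2, Finset.HasAntidiagonal.mem_antidiagonal.2 rfl⟩⟩
  left_inv := by
    rintro ⟨⟨a, s⟩, ⟨p, hp⟩⟩
    obtain rfl := Finset.HasAntidiagonal.mem_antidiagonal.1 hp
    rfl
  right_inv _ := rfl

theorem multinomial_two (a b : ℕ) :
    Nat.multinomial Finset.univ ![a, b] = (a + b).choose a := by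
  rw [Nat.multinomial_univ_two, Nat.choose_symm_add, Nat.add_choose]

theorem multinomial_three (a b c : ℕ) :
    Nat.multinomial Finset.univ ![a, b, c] = (a + (b + c)).choose a * (b + c).choose b := by
  rw [Nat.multinomial_univ_three]
  have h₁ := Nat.add_choose_mul_factorial_mul_factorial a (b + c)
  have h₂ := Nat.add_choose_mul_factorial_mul_factorial b c
  rw [← Nat.choose_symm_add] at h₁ h₂
  refine Nat.div_eq_of_eq_mul_left (by positivity) ?_
  rw [add_assoc, ← h₁, ← h₂]
  ring

theorem summable_choose_sq {x y : ℝ} (h : |x| + |y| < 1) :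
    Summable fun p : ℕ × ℕ =>
      ((p.1 + p.2).choose p.1 : ℝ) ^ 2 * ((x ^ 2) ^ p.1 * (y ^ 2) ^ p.2) := by
  have hs := multinomialSqSummable_sq (x := ![x, y]) (by simpa [Fin.sum_univ_two] using h)
  refine ((finTwoArrowEquiv ℕ).symm.summable_iff.2 hs).congr fun p => ?_
  simp [Fin.prod_univ_two, multinomial_two]

theorem sq_add_sq_add_two_mul_cos_mem (x y φ : ℝ) :
    0 ≤ x ^ 2 + y ^ 2 + 2 * x * y * Real.cos φ ∧
      x ^ 2 + y ^ 2 + 2 * x * y * Real.cos φ ≤ (|x| + |y|) ^ 2 := by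
  have h : |x * y * Real.cos φ| ≤ |x| * |y| := by
    rw [abs_mul, abs_mul]
    exact mul_le_of_le_one_right (by positivity) (Real.abs_cos_le_one φ)
  obtain ⟨h₁, h₂⟩ := abs_le.1 h
  have hx := sq_abs x
  have hy := sq_abs y
  constructor <;> nlinarith [sq_nonneg (|x| - |y|)]

theorem hasSum_choose_sq {x y : ℝ} (h : |x| + |y| < 1) :
    HasSum (fun p : ℕ × ℕ =>
        ((p.1 + p.2).choose p.1 : ℝ) ^ 2 * ((x ^ 2) ^ p.1 * (y ^ 2) ^ p.2))
      (1 / √((1 - x ^ 2 - y ^ 2) ^ 2 - 4 * x ^ 2 * y ^ 2)) := by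
  have hsum := summable_choose_sq h
  have hr0 : 0 ≤ (|x| + |y|) ^ 2 := by positivity
  have hr1 : (|x| + |y|) ^ 2 < 1 := by
    rw [sq_lt_one_iff₀ (by positivity)]
    exact h
  have hgeom : HasSum
      (fun n : ℕ => ∫ φ in (0 : ℝ)..Real.pi, (x ^ 2 + y ^ 2 + 2 * x * y * Real.cos φ) ^ n)
      (∫ φ in (0 : ℝ)..Real.pi, 1 / ((1 - x ^ 2 - y ^ 2) - 2 * x * y * Real.cos φ)) := by
    refine intervalIntegral.hasSum_integral_of_dominated_convergence
      (fun n _ => ((|x| + |y|) ^ 2) ^ n)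
      (fun n => (by fun_prop : Continuous _).aestronglyMeasurable)
      (fun n => ae_of_all _ fun φ _ => ?_)
      (ae_of_all _ fun φ _ => summable_geometric_of_lt_one hr0 hr1)
      intervalIntegrable_const (ae_of_all _ fun φ _ => ?_)
    · obtain ⟨h0, h1⟩ := sq_add_sq_add_two_mul_cos_mem x y φ
      rw [Real.norm_of_nonneg (pow_nonneg h0 n)]
      exact pow_le_pow_left₀ h0 h1 n
    · obtain ⟨h0, h1⟩ := sq_add_sq_add_two_mul_cos_mem x y φ
      have hval : 1 - x ^ 2 - y ^ 2 - 2 * x * y * Real.cos φ =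
          1 - (x ^ 2 + y ^ 2 + 2 * x * y * Real.cos φ) := by ring
      rw [one_div, hval]
      exact hasSum_geometric_of_lt_one h0 (h1.trans_lt hr1)
  -- Equivalent to `(|x| + |y|)² < 1`.
  have hQ : |2 * x * y| < 1 - x ^ 2 - y ^ 2 := by
    rw [abs_mul, abs_mul, abs_two]
    nlinarith [sq_abs x, sq_abs y]
  rw [integral_one_div_sub_mul_cos hQ] at hgeom
  simp_rw [integral_sq_add_sq_add_two_mul_cos_pow] at hgeom
  have hgrouped := (Finset.HasAntidiagonal.sigmaAntidiagonalEquivProd.hasSum_iff.2 hsum.hasSum).sigma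
    fun n => hasSum_fintype _
  have hval := (hgrouped.mul_left Real.pi).unique ((hgeom.congr_left fun n => by
    rw [← Finset.sum_coe_sort]
    rfl))
  have : ∑' p : ℕ × ℕ, ((p.1 + p.2).choose p.1 : ℝ) ^ 2 * ((x ^ 2) ^ p.1 * (y ^ 2) ^ p.2) =
      1 / √((1 - x ^ 2 - y ^ 2) ^ 2 - 4 * x ^ 2 * y ^ 2) := by
    rw [div_eq_mul_one_div] at hval
    rw [mul_left_cancel₀ Real.pi_ne_zero hval]
    congr 3
    ring
  exact this ▸ hsum.hasSum

theorem multinomialSqGF_two {x y : ℝ} (h : |x| + |y| < 1) :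
    multinomialSqGF ![x ^ 2, y ^ 2] = 1 / √((1 - x ^ 2 - y ^ 2) ^ 2 - 4 * x ^ 2 * y ^ 2) := by
  rw [← (hasSum_choose_sq h).tsum_eq, multinomialSqGF, ← (finTwoArrowEquiv ℕ).symm.tsum_eq]
  refine tsum_congr fun p => ?_
  simp [Fin.prod_univ_two, multinomial_two]

theorem multinomialSqGF_three_eq_integral {x y z : ℝ} (h : |x| + |y| + |z| < 1) :
    Real.pi * multinomialSqGF ![x ^ 2, y ^ 2, z ^ 2] =
      ∫ φ in (0 : ℝ)..Real.pi,
        1 / √(((1 + x) ^ 2 - y ^ 2 - z ^ 2 - 2 * y * z * Real.cos φ) *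
          ((1 - x) ^ 2 - y ^ 2 - z ^ 2 - 2 * y * z * Real.cos φ)) := by
  have hsum3 := multinomialSqSummable_sq (x := ![x, y, z])
    (by simpa [Fin.sum_univ_three] using h)
  have hsum : Summable fun p : ℕ × ℕ × ℕ =>
      ((p.1 + (p.2.1 + p.2.2)).choose p.1 : ℝ) ^ 2 * ((x ^ 2) ^ p.1) *
        (((p.2.1 + p.2.2).choose p.2.1 : ℝ) ^ 2 * ((y ^ 2) ^ p.2.1 * (z ^ 2) ^ p.2.2)) := by
    refine (prodProdEquivFinThree.summable_iff.2 hsum3).congr fun p => ?_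
    change (Nat.multinomial Finset.univ ![p.1, p.2.1, p.2.2] : ℝ) ^ 2 * _ = _
    rw [multinomial_three, Fin.prod_univ_three]
    change _ * ((x ^ 2) ^ p.1 * (y ^ 2) ^ p.2.1 * (z ^ 2) ^ p.2.2) = _
    push_cast
    ring
  have htsum : multinomialSqGF ![x ^ 2, y ^ 2, z ^ 2] = ∑' p : ℕ × ℕ × ℕ,
      ((p.1 + (p.2.1 + p.2.2)).choose p.1 : ℝ) ^ 2 * ((x ^ 2) ^ p.1) *
        (((p.2.1 + p.2.2).choose p.2.1 : ℝ) ^ 2 * ((y ^ 2) ^ p.2.1 * (z ^ 2) ^ p.2.2)) := by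
    rw [multinomialSqGF, ← prodProdEquivFinThree.tsum_eq]
    refine tsum_congr fun p => ?_
    change (Nat.multinomial Finset.univ ![p.1, p.2.1, p.2.2] : ℝ) ^ 2 * _ = _
    rw [multinomial_three, Fin.prod_univ_three]
    change _ * ((x ^ 2) ^ p.1 * (y ^ 2) ^ p.2.1 * (z ^ 2) ^ p.2.2) = _
    push_cast
    ring
  have hyz : |(|y| + |z|)| = |y| + |z| := abs_of_nonneg (by positivity)
  have hint : HasSum (fun q : ℕ × ℕ => ∫ φ in (0 : ℝ)..Real.pi,
        ((q.1 + q.2).choose q.1 : ℝ) ^ 2 * (x ^ 2) ^ q.1 *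
          (y ^ 2 + z ^ 2 + 2 * y * z * Real.cos φ) ^ q.2)
      (∫ φ in (0 : ℝ)..Real.pi,
        1 / √(((1 + x) ^ 2 - y ^ 2 - z ^ 2 - 2 * y * z * Real.cos φ) *
          ((1 - x) ^ 2 - y ^ 2 - z ^ 2 - 2 * y * z * Real.cos φ))) := by
    refine intervalIntegral.hasSum_integral_of_dominated_convergence
      (fun q _ => ((q.1 + q.2).choose q.1 : ℝ) ^ 2 *
        ((x ^ 2) ^ q.1 * ((|y| + |z|) ^ 2) ^ q.2))
      (fun n => (by fun_prop : Continuous _).aestronglyMeasurable)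
      (fun q => ae_of_all _ fun φ _ => ?_)
      -- As `ρ ≤ |y| + |z|`, the dominating series is the two-variable one at `(x, |y| + |z|)`.
      (ae_of_all _ fun φ _ => summable_choose_sq (by rw [hyz]; linarith))
      intervalIntegrable_const (ae_of_all _ fun φ _ => ?_)
    · obtain ⟨h0, h1⟩ := sq_add_sq_add_two_mul_cos_mem y z φ
      rw [Real.norm_of_nonneg (by positivity), mul_assoc]
      gcongr
    · obtain ⟨h0, h1⟩ := sq_add_sq_add_two_mul_cos_mem y z φ
      have hs : √(y ^ 2 + z ^ 2 + 2 * y * z * Real.cos φ) ≤ |y| + |z| :=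
        Real.sqrt_le_iff.2 ⟨by positivity, h1⟩
      -- For fixed `φ` the integrands sum to `M₂(x², ρ²)`, with `ρ = √(y² + z² + 2yz cos φ)` as
      -- second variable.
      have key := hasSum_choose_sq (x := x) (y := √(y ^ 2 + z ^ 2 + 2 * y * z * Real.cos φ))
        (by rw [abs_of_nonneg (Real.sqrt_nonneg _)]; linarith)
      rw [Real.sq_sqrt h0] at key
      have hval : ((1 + x) ^ 2 - y ^ 2 - z ^ 2 - 2 * y * z * Real.cos φ) *
          ((1 - x) ^ 2 - y ^ 2 - z ^ 2 - 2 * y * z * Real.cos φ) =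
          (1 - x ^ 2 - (y ^ 2 + z ^ 2 + 2 * y * z * Real.cos φ)) ^ 2 -
            4 * x ^ 2 * (y ^ 2 + z ^ 2 + 2 * y * z * Real.cos φ) := by ring
      rw [hval]
      exact key.congr_left fun q => (mul_assoc _ _ _).symm
  simp_rw [intervalIntegral.integral_const_mul, integral_sq_add_sq_add_two_mul_cos_pow] at hint
  have hgrouped := (sigmaAntidiagonalEquivProdProd.hasSum_iff.2 hsum.hasSum).sigma
    fun n => hasSum_fintype _
  rw [htsum]
  refine (hgrouped.mul_left Real.pi).unique (hint.congr_left fun q => ?_)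
  rw [Finset.mul_sum, Finset.mul_sum, Finset.mul_sum, ← Finset.sum_coe_sort]
  refine Finset.sum_congr rfl fun p _ => ?_
  have hp := Finset.HasAntidiagonal.mem_antidiagonal.1 p.2
  simp only [sigmaAntidiagonalEquivProdProd, Function.comp_apply, ← hp]
  change _ = Real.pi * (((q.1 + (p.1.1 + p.1.2)).choose q.1 : ℝ) ^ 2 * (x ^ 2) ^ q.1 *
    (((p.1.1 + p.1.2).choose p.1.1 : ℝ) ^ 2 * ((y ^ 2) ^ p.1.1 * (z ^ 2) ^ p.1.2)))
  ring

/-! ### Counting lattice paths -/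

theorem length_eq_sum_of_mem_latticePaths {r : ℕ} {α : Fin r → ℕ} {p : List (Fin r → ℤ)}
    (hp : p ∈ latticePaths α) : p.length = ∑ i, α i := by
  have key : ∀ q : List (Fin r → ℤ), (∀ v ∈ q, ∃ i, v = Pi.single i 1) →
      ∑ i, q.sum i = (q.length : ℤ) := by
    intro q
    induction q with
    | nil => simp
    | cons v q ih =>
      intro hq
      obtain ⟨i, hi⟩ := hq v (by simp)
      have := ih fun w hw => hq w (by simp [hw])
      simp only [List.sum_cons, Pi.add_apply, Finset.sum_add_distrib, this, hi,
        List.length_cons, Finset.sum_pi_single', Finset.mem_univ, if_true]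
      push_cast
      ring
  have h := key p hp.1
  rw [hp.2] at h
  dsimp only at h
  exact_mod_cast h.symm

theorem latticePaths_zero {r : ℕ} : latticePaths (0 : Fin r → ℕ) = {[]} := by
  ext p
  constructor
  · intro hp
    have := length_eq_sum_of_mem_latticePaths hp
    simpa using this
  · rintro rfl
    exact ⟨by simp, by ext; simp⟩

/-- Paths are sorted by their first step, which must be in a direction with `0 < α i`; there the
truncated subtraction is exact. -/
theorem latticePaths_eq_iUnion {r : ℕ} {α : Fin r → ℕ} (hα : α ≠ 0) :
    latticePaths α = ⋃ i ∈ Finset.univ.filter (fun i => 0 < α i),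
      List.cons (Pi.single i 1) '' latticePaths (α - (Pi.single i 1 : Fin r → ℕ)) := by
  have hcast : ∀ i : Fin r, 0 < α i → ∀ j,
      (((α - (Pi.single i 1 : Fin r → ℕ)) j : ℕ) : ℤ) = (α j : ℤ) - (Pi.single i 1 : Fin r → ℤ) j := by
    intro i hi j
    rcases eq_or_ne j i with rfl | hij
    · simp [Nat.cast_sub (Nat.one_le_of_lt hi)]
    · simp [hij]
  ext p
  simp only [Set.mem_iUnion, Finset.mem_filter, Finset.mem_univ, true_and, exists_prop,
    Set.mem_image]
  constructor
  · intro hp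
    cases p with
    | nil =>
      refine absurd ?_ hα
      have h := hp.2
      ext i
      have := congrFun h i
      simpa using this.symm
    | cons v q =>
      obtain ⟨i, rfl⟩ := hp.1 v (by simp)
      have hnn : ∀ l : List (Fin r → ℤ), (∀ v ∈ l, ∃ i, v = Pi.single i 1) → 0 ≤ l.sum i := by
        intro l
        induction l with
        | nil => simp
        | cons w l ih =>
          intro hl
          obtain ⟨j, rfl⟩ := hl w (by simp)
          have h1 := ih fun w hw => hl w (by simp [hw])
          have h2 : 0 ≤ (Pi.single j 1 : Fin r → ℤ) i := by
            rw [Pi.single_apply]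
            split_ifs <;> simp
          simpa using add_nonneg h2 h1
      have hq : ∀ v ∈ q, ∃ i, v = Pi.single i 1 := fun w hw => hp.1 w (by simp [hw])
      have hs := hp.2
      have hi : 0 < α i := by
        have h1 := congrFun hs i
        have h2 := hnn q hq
        simp at h1
        omega
      refine ⟨i, hi, q, ⟨hq, ?_⟩, rfl⟩
      ext j
      rw [hcast i hi, ← congrFun hs j]
      simp
  · rintro ⟨i, hi, q, ⟨hq, hs⟩, rfl⟩
    refine ⟨fun v hv => ?_, ?_⟩
    · rcases List.mem_cons.1 hv with rfl | hv
      · exact ⟨i, rfl⟩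
      · exact hq v hv
    · ext j
      rw [List.sum_cons, hs, Pi.add_apply, hcast i hi]
      ring

/-- Induction on the length: the paths starting in direction `i` contribute `α i * n!`, and `∑ α i =
n + 1`. Finiteness is carried along because the `ncard` of the union is additive only for finite
pieces. -/
theorem latticePaths_finite_and_prod_factorial_mul_ncard {r : ℕ} (n : ℕ) :
    ∀ α : Fin r → ℕ, ∑ i, α i = n → (latticePaths α).Finite ∧
      (∏ i, (α i).factorial) * (latticePaths α).ncard = n.factorial := by
  induction n with
  | zero =>
    intro α hα
    have : α = 0 := by
      ext i
      exact (Finset.sum_eq_zero_iff.1 hα) i (Finset.mem_univ i)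
    subst this
    rw [latticePaths_zero]
    simp
  | succ n ih =>
    intro α hα
    have hα0 : α ≠ 0 := by
      rintro rfl
      simp at hα
    have hsub : ∀ i, 0 < α i → ∑ j, (α - (Pi.single i 1 : Fin r → ℕ)) j = n := by
      intro i hi
      have h : α = (α - (Pi.single i 1 : Fin r → ℕ)) + Pi.single i 1 := by
        ext j
        rcases eq_or_ne j i with rfl | hij
        · simp; omega
        · simp [hij]
      rw [h] at hα
      simp only [Pi.add_apply, Finset.sum_add_distrib, Finset.sum_pi_single', Finset.mem_univ,
        if_true] at hα
      omega
    have hinj : ∀ v : Fin r → ℤ, Function.Injective (List.cons v) :=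
      fun v => List.cons_injective
    have hfin : ∀ i ∈ Finset.univ.filter (fun i => 0 < α i),
        (List.cons (Pi.single i 1) '' latticePaths (α - (Pi.single i 1 : Fin r → ℕ))).Finite :=
      fun i hi => ((ih _ (hsub i (Finset.mem_filter.1 hi).2)).1).image _
    have hdisj : (↑(Finset.univ.filter fun i => 0 < α i) : Set (Fin r)).PairwiseDisjoint
        fun i => List.cons (Pi.single i (1 : ℤ)) '' latticePaths (α - (Pi.single i 1 : Fin r → ℕ)) := by
      intro i _ j _ hij
      refine Set.disjoint_left.2 ?_
      rintro _ ⟨p, _, rfl⟩ ⟨q, _, hq⟩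
      have h := congrFun (List.cons.inj hq).1 j
      simp [hij.symm] at h
    rw [latticePaths_eq_iUnion hα0]
    refine ⟨Set.Finite.biUnion (Finset.finite_toSet _) hfin, ?_⟩
    have hcard := Set.Finite.ncard_biUnion (Finset.finite_toSet _) hfin hdisj
    rw [finsum_mem_coe_finset] at hcard
    simp only [Finset.mem_coe] at hcard
    rw [hcard, Finset.mul_sum]
    have hterm : ∀ i ∈ Finset.univ.filter (fun i => 0 < α i), (∏ j, (α j).factorial) *
        (List.cons (Pi.single i (1 : ℤ)) '' latticePaths (α - (Pi.single i 1 : Fin r → ℕ))).ncard =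
          α i * n.factorial := by
      intro i hi
      have hi' : 0 < α i := (Finset.mem_filter.1 hi).2
      rw [Set.ncard_image_of_injective _ (hinj _), ← (ih _ (hsub i hi')).2, ← mul_assoc,
        ← Finset.mul_prod_erase _ _ (Finset.mem_univ i),
        ← Finset.mul_prod_erase _ (fun j => ((α - (Pi.single i 1 : Fin r → ℕ)) j).factorial)
          (Finset.mem_univ i), ← mul_assoc]
      congr 2
      · simp [Nat.mul_factorial_pred hi'.ne']
      · refine Finset.prod_congr rfl fun j hj => ?_
        simp [Finset.ne_of_mem_erase hj]
    rw [Finset.sum_congr rfl hterm, ← Finset.sum_mul,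
      Finset.sum_filter_of_ne fun i _ hi => Nat.pos_of_ne_zero hi, hα, Nat.factorial_succ]

theorem ncard_latticePaths {r : ℕ} (α : Fin r → ℕ) :
    (latticePaths α).ncard = Nat.multinomial Finset.univ α := by
  have h := (latticePaths_finite_and_prod_factorial_mul_ncard _ α rfl).2
  rw [← Nat.multinomial_spec] at h
  exact Nat.eq_of_mul_eq_mul_left (Finset.prod_pos fun i _ => Nat.factorial_pos _) h

/-! ### Symmetry, positivity and the final formulas -/

theorem signedKappa_comp_perm (τ : ℤˣ) (π : Equiv.Perm (Fin 3)) (x : Fin 3 → ℝ) :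
    signedKappa τ (x ∘ π) = signedKappa τ x := by
  rw [signedKappa, signedKappa]
  refine Finset.prod_equiv (Equiv.arrowCongr π (Equiv.refl ℤˣ)) (fun σ => ?_) fun σ _ => ?_
  · simp [Equiv.arrowCongr, Equiv.prod_comp π.symm (fun i => σ i)]
  · rw [← Equiv.sum_comp π fun i =>
      (((Equiv.arrowCongr π (Equiv.refl ℤˣ) σ i : ℤˣ) : ℤ) : ℝ) * x i]
    simp [Equiv.arrowCongr]

theorem ellipticModulus_comp_perm (π : Equiv.Perm (Fin 3)) (x : Fin 3 → ℝ) :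
    ellipticModulus (x ∘ π) = ellipticModulus x := by
  simp only [ellipticModulus, signedKappa_comp_perm]

theorem ellipticPrefactor_comp_perm (π : Equiv.Perm (Fin 3)) (x : Fin 3 → ℝ) :
    ellipticPrefactor (x ∘ π) = ellipticPrefactor x := by
  simp only [ellipticPrefactor, signedKappa_comp_perm]

theorem abs_add_abs_add_abs_lt_one {x y z : ℝ} (h : |x| + |y| + |z| < 1) :
    (0 < 1 + x + y + z ∧ 0 < 1 + x - y - z ∧ 0 < 1 - x + y - z ∧ 0 < 1 - x - y + z) ∧
      (0 < 1 - x - y - z ∧ 0 < 1 - x + y + z ∧ 0 < 1 + x - y + z ∧ 0 < 1 + x + y - z) := by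
  have hx := abs_le.1 (le_refl |x|)
  have hy := abs_le.1 (le_refl |y|)
  have hz := abs_le.1 (le_refl |z|)
  refine ⟨⟨?_, ?_, ?_, ?_⟩, ?_, ?_, ?_, ?_⟩ <;> linarith

theorem signedKappa_one {x y z : ℝ} (h : |x| + |y| + |z| < 1) :
    signedKappa 1 ![x, y, z] =
      √((1 + x + y + z) * (1 + x - y - z) * ((1 - x + y - z) * (1 - x - y + z))) := by
  obtain ⟨⟨h₁, h₂, h₃, h₄⟩, -⟩ := abs_add_abs_add_abs_lt_one h
  have hset : (Finset.univ.filter fun σ : Fin 3 → ℤˣ => ∏ i, σ i = 1) =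
      {![1, 1, 1], ![1, -1, -1], ![-1, 1, -1], ![-1, -1, 1]} := by decide
  rw [signedKappa, hset, Finset.prod_insert (by decide), Finset.prod_insert (by decide),
    Finset.prod_insert (by decide), Finset.prod_singleton, Real.sqrt_mul (by positivity),
    Real.sqrt_mul h₁.le, Real.sqrt_mul h₃.le, mul_assoc]
  simp only [Fin.sum_univ_three]
  simp [sub_eq_add_neg, add_assoc]

theorem signedKappa_neg_one {x y z : ℝ} (h : |x| + |y| + |z| < 1) :
    signedKappa (-1) ![x, y, z] =
      √((1 - x - y - z) * (1 - x + y + z) * ((1 + x - y + z) * (1 + x + y - z))) := by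
  obtain ⟨-, h₁, h₂, h₃, h₄⟩ := abs_add_abs_add_abs_lt_one h
  have hset : (Finset.univ.filter fun σ : Fin 3 → ℤˣ => ∏ i, σ i = -1) =
      {![-1, -1, -1], ![-1, 1, 1], ![1, -1, 1], ![1, 1, -1]} := by decide
  rw [signedKappa, hset, Finset.prod_insert (by decide), Finset.prod_insert (by decide),
    Finset.prod_insert (by decide), Finset.prod_singleton, Real.sqrt_mul (by positivity),
    Real.sqrt_mul h₁.le, Real.sqrt_mul h₃.le, mul_assoc]
  simp only [Fin.sum_univ_three]
  simp [sub_eq_add_neg, add_assoc]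

theorem sqrt_signedKappa_pos (τ : ℤˣ) {x y z : ℝ} (h : |x| + |y| + |z| < 1) :
    0 < √(signedKappa τ ![x, y, z]) := by
  obtain ⟨⟨h₁, h₂, h₃, h₄⟩, h₅, h₆, h₇, h₈⟩ := abs_add_abs_add_abs_lt_one h
  rcases Int.units_eq_one_or τ with rfl | rfl
  · rw [signedKappa_one h]
    positivity
  · rw [signedKappa_neg_one h]
    positivity

theorem ellipticModulus_lt_one {x y z : ℝ} (h : |x| + |y| + |z| < 1) :
    ellipticModulus ![x, y, z] < 1 := by
  have ha := sqrt_signedKappa_pos 1 h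
  have hb := sqrt_signedKappa_pos (-1) h
  rw [ellipticModulus, div_pow, div_lt_one (by positivity)]
  nlinarith [mul_pos ha hb]

theorem multinomialSqGF_three {x y z : ℝ} (h : |x| + |y| + |z| < 1) :
    multinomialSqGF ![x ^ 2, y ^ 2, z ^ 2] =
      ellipticPrefactor ![x, y, z] * ellipticK (ellipticModulus ![x, y, z]) := by
  obtain ⟨⟨h₁, h₂, h₃, h₄⟩, h₅, h₆, h₇, h₈⟩ := abs_add_abs_add_abs_lt_one h
  have ha := sqrt_signedKappa_pos 1 h
  have hb := sqrt_signedKappa_pos (-1) h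
  have hM := multinomialSqGF_three_eq_integral h
  -- Both bounds hold because `(1 ± x)² - (y + z)²` and `(1 ± x)² - (y - z)²` are products of two of
  -- the eight positive linear forms; the same factorisations produce `κ₊` and `κ₋` below.
  have hQ₁ : |2 * y * z| < (1 + x) ^ 2 - y ^ 2 - z ^ 2 :=
    abs_lt.2 ⟨by nlinarith [mul_pos h₇ h₈], by nlinarith [mul_pos h₁ h₂]⟩
  have hQ₂ : |2 * y * z| < (1 - x) ^ 2 - y ^ 2 - z ^ 2 :=
    abs_lt.2 ⟨by nlinarith [mul_pos h₃ h₄], by nlinarith [mul_pos h₅ h₆]⟩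
  rw [integral_one_div_sqrt_mul_eq_agmIntegral hQ₁ hQ₂,
    show ((1 + x) ^ 2 - y ^ 2 - z ^ 2 - 2 * y * z) * ((1 - x) ^ 2 - y ^ 2 - z ^ 2 + 2 * y * z) =
      (1 + x + y + z) * (1 + x - y - z) * ((1 - x + y - z) * (1 - x - y + z)) by ring,
    show ((1 + x) ^ 2 - y ^ 2 - z ^ 2 + 2 * y * z) * ((1 - x) ^ 2 - y ^ 2 - z ^ 2 - 2 * y * z) =
      (1 - x - y - z) * (1 - x + y + z) * ((1 + x - y + z) * (1 + x + y - z)) by ring,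
    ← signedKappa_one h, ← signedKappa_neg_one h,
    ← Real.sq_sqrt (Real.sqrt_pos.1 ha).le, ← Real.sq_sqrt (Real.sqrt_pos.1 hb).le,
    agmIntegral_sq_sq ha hb] at hM
  rw [ellipticPrefactor, ellipticModulus]
  refine mul_left_cancel₀ Real.pi_ne_zero (hM.trans ?_)
  field_simp
  ring

theorem signedKappa_zero {x y : ℝ} (h : |x| + |y| < 1) (τ : ℤˣ) :
    signedKappa τ ![x, y, 0] = √((1 - (x ^ 2 + y ^ 2)) ^ 2 - 4 * x ^ 2 * y ^ 2) := by
  have h' : |x| + |y| + |(0 : ℝ)| < 1 := by simpa using h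
  rcases Int.units_eq_one_or τ with rfl | rfl
  · rw [signedKappa_one h']
    congr 1
    ring
  · rw [signedKappa_neg_one h']
    congr 1
    ring

theorem multinomialSqGF_snoc_zero (u v : ℝ) :
    multinomialSqGF ![u, v, 0] = multinomialSqGF ![u, v] := by
  have hinj : Function.Injective fun p : ℕ × ℕ => (![p.1, p.2, 0] : Fin 3 → ℕ) := by
    rintro ⟨a, b⟩ ⟨c, d⟩ h
    exact Prod.ext (congrFun h 0) (congrFun h 1)
  rw [multinomialSqGF, multinomialSqGF, ← (finTwoArrowEquiv ℕ).symm.tsum_eq, ← hinj.tsum_eq]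
  · refine tsum_congr fun p => ?_
    simp [Fin.prod_univ_two, Fin.prod_univ_three, multinomial_two, multinomial_three]
  -- With third variable `0`, only `α 2 = 0` contributes, through `0 ^ 0 = 1`.
  · intro α hα
    have h2 : α 2 = 0 := by
      by_contra h
      refine hα ?_
      simp [Fin.prod_univ_three, h]
    refine ⟨(α 0, α 1), ?_⟩
    ext i
    fin_cases i <;> simp [h2]

theorem mainTheorem6 :
    -- the coefficients count pairs of lattice paths in three dimensions
    (∀ α : Fin 3 → ℕ,
      (latticePaths α ×ˢ latticePaths α).ncard = Nat.multinomial Finset.univ α ^ 2) ∧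
    -- the formula
    (∀ x : Fin 3 → ℝ, ∑ i, |x i| < 1 →
      0 ≤ ellipticModulus x ∧ ellipticModulus x < 1 ∧
      MultinomialSqSummable (fun i => x i ^ 2) ∧
      multinomialSqGF (fun i => x i ^ 2) =
        ellipticPrefactor x * ellipticK (ellipticModulus x)) ∧
    -- symmetry of the modulus and of the prefactor
    (∀ (π : Equiv.Perm (Fin 3)) (x : Fin 3 → ℝ),
      ellipticModulus (x ∘ π) = ellipticModulus x ∧
      ellipticPrefactor (x ∘ π) = ellipticPrefactor x) ∧
    -- specialization to `x₃ = 0`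
    (ellipticK 0 = Real.pi / 2 ∧
      ∀ x₁ x₂ : ℝ, |x₁| + |x₂| < 1 →
        (∀ τ : ℤˣ, signedKappa τ ![x₁, x₂, 0] =
          Real.sqrt ((1 - (x₁ ^ 2 + x₂ ^ 2)) ^ 2 - 4 * x₁ ^ 2 * x₂ ^ 2)) ∧
        ellipticModulus ![x₁, x₂, 0] = 0 ∧
        ellipticPrefactor ![x₁, x₂, 0] =
          2 / (Real.pi *
            Real.sqrt ((1 - (x₁ ^ 2 + x₂ ^ 2)) ^ 2 - 4 * x₁ ^ 2 * x₂ ^ 2)) ∧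
        MultinomialSqSummable ![x₁ ^ 2, x₂ ^ 2] ∧
        multinomialSqGF ![x₁ ^ 2, x₂ ^ 2, 0] = multinomialSqGF ![x₁ ^ 2, x₂ ^ 2] ∧
        multinomialSqGF ![x₁ ^ 2, x₂ ^ 2] =
          1 / Real.sqrt ((1 - (x₁ ^ 2 + x₂ ^ 2)) ^ 2 - 4 * x₁ ^ 2 * x₂ ^ 2)) := by
  refine ⟨fun α => ?_, fun x hx => ?_, fun π x => ⟨ellipticModulus_comp_perm π x,
    ellipticPrefactor_comp_perm π x⟩, ?_, fun x y h => ?_⟩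
  · rw [Set.ncard_prod, ncard_latticePaths, sq]
  · have h : |x 0| + |x 1| + |x 2| < 1 := by simpa [Fin.sum_univ_three] using hx
    have hvec : ![x 0, x 1, x 2] = x := by
      ext i
      fin_cases i <;> rfl
    have hsq : ![x 0 ^ 2, x 1 ^ 2, x 2 ^ 2] = fun i => x i ^ 2 := by
      ext i
      fin_cases i <;> rfl
    have hlt := ellipticModulus_lt_one h
    have hM := multinomialSqGF_three h
    rw [hvec] at hlt hM
    rw [hsq] at hM
    exact ⟨sq_nonneg _, hlt, multinomialSqSummable_sq hx, hM⟩
  · rw [ellipticK_eq_agmIntegral le_rfl one_pos]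
    simpa using agmIntegral_one_one
  · have hκ := signedKappa_zero h
    have hsq : ![x ^ 2, y ^ 2] = fun i => ![x, y] i ^ 2 := by
      ext i
      fin_cases i <;> rfl
    refine ⟨hκ, ?_, ?_, ?_, multinomialSqGF_snoc_zero _ _, ?_⟩
    · simp [ellipticModulus, hκ]
    · rw [ellipticPrefactor, hκ, hκ, ← two_mul, mul_pow, Real.sq_sqrt (Real.sqrt_nonneg _),
        mul_left_comm, ← div_div]
      norm_num
    · rw [hsq]
      exact multinomialSqSummable_sq (by simpa [Fin.sum_univ_two] using h)
    · rw [multinomialSqGF_two h, sub_sub]
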